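/- Let $\phi:\mathbb R\to\mathbb R$ be twice differentiable with $|\phi'|\le 1$, $|\phi''|\le\beta$ for some constant $\beta$, and $\phi(0)=0$. Let $L\ge 1$, let $m_0,m_1,\dots,m_L$ be layer widths ($m_0=d$ is the input dimension), and for $\theta=(W^{(1)},\dots,W^{(L)},\mathbf v)$ with $W^{(l)}\in\mathbb R^{m_l\times m_{l-1}}$ and $\mathbf v\in\mathbb R^{m_L}$ let $f(\theta;\cdot)$ be the WeightNorm network $$\alpha^{(0)}(\mathbf x)=\mathbf x,\qquad \alpha^{(l)}_i(\mathbf x)=\phi\Big(\tfrac{1}{\sqrt{m_l}}\tfrac{(W^{(l)}_i)^\top}{\|W^{(l)}_i\|_2}\alpha^{(l-1)}(\mathbf x)\Big)\ (1\le i\le m_l,\ 1\le l\le L),\qquad f(\theta;\mathbf x)=\mathbf v^\top\alpha^{(L)}(\mathbf x),$$ where $W_i^{(l)}$ is the $i$-th row of $W^{(l)}$ and $w/\|w\|_2:=0$ for $w=0$. Fix $\mathbf v_0\in\mathbb R^{m_L}$ with $\|\mathbf v_0\|_2=1$ and $\rho_1>0$. Let $\mathcal D$ be a probability distribution on $\mathbb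 R^{d}\times\mathbb R$ such that $\|\mathbf x\|_2=1$ and $|y|\le 1$ for $\mathcal D$-almost every $(\mathbf x,y)$. For a sample $S=((\mathbf x_i,y_i))_{i=1}^n$, $n\ge1$, put $$\mathcal L_S(\theta)=\frac1n\sum_{i=1}^n (y_i-f(\theta;\mathbf x_i))^2,\qquad \mathcal L_{\mathcal D}(\theta)=\mathbb E_{(\mathbf x,y)\sim\mathcal D}\big[(y-f(\theta;\mathbf x))^2\big].$$ Then for every $\delta\in(0,1)$, with probability at least $1-\delta$ over the draw of $S$ consisting of $n$ i.i.d. pairs from $\mathcal D$, the following holds simultaneously for all $\theta$ with $\|\mathbf v-\mathbf v_0\|_2\le\rho_1$: $$\mathcal L_{\mathcal D}(\theta)-\mathcal L_S(\theta)\le 4(2+\rho_1)(1+\rho_1)\frac{\sqrt{2\log(2)\,L}+1}{\sqrt n}+2\big(1+(1+\rho_1)^2\big)\frac{\sqrt{2\log(2/\delta)}}{\sqrt n}.$$ In particular the bound does not involve the widths. -/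

import Mathlib

open MeasureTheory

noncomputable section

namespace WeightNorm

/-- The parameter `θ` of a depth `L` network with layer widths `m 0, m 1, …, m L` (`m 0` is the
input dimension). `W l i` is the weight vector of the `i`-th neuron of layer `l + 1`, that is, the
`i`-th row of the weight matrix of size `m (l + 1) × m l`; `v` is the vector of the linear output
layer. -/
structure Params (L : ℕ) (m : ℕ → ℕ) where
  W : (l : Fin L) → Fin (m (l + 1)) → EuclideanSpace ℝ (Fin (m l))
  v : EuclideanSpace ℝ (Fin (m L))

/-- One WeightNorm layer: the `i`-th entry of the output is
`φ ((1 / √q) * ⟨w i / ‖w i‖, a⟩)`. For `w i = 0` the normalized vector is `0`. -/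
def layer (φ : ℝ → ℝ) {p q : ℕ} (w : Fin q → EuclideanSpace ℝ (Fin p))
    (a : EuclideanSpace ℝ (Fin p)) : EuclideanSpace ℝ (Fin q) :=
  WithLp.toLp 2 fun i => φ (1 / √(q : ℝ) * inner ℝ (‖w i‖⁻¹ • w i) a)

/-- The activation vector `α⁽ˡ⁾(x)` of layer `l ≤ L`, starting from `α⁽⁰⁾(x) = x`. -/
def activation (φ : ℝ → ℝ) {L : ℕ} {m : ℕ → ℕ} (θ : Params L m)
    (x : EuclideanSpace ℝ (Fin (m 0))) : (l : ℕ) → l ≤ L → EuclideanSpace ℝ (Fin (m l))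
  | 0, _ => x
  | l + 1, h => layer φ (θ.W ⟨l, h⟩) (activation φ θ x l (Nat.le_of_succ_le h))

/-- The WeightNorm network `f(θ; x) = vᵀ α⁽ᴸ⁾(x)`. -/
def predictor (φ : ℝ → ℝ) {L : ℕ} {m : ℕ → ℕ} (θ : Params L m)
    (x : EuclideanSpace ℝ (Fin (m 0))) : ℝ :=
  inner ℝ θ.v (activation φ θ x L le_rfl)

/-- The square loss `ℓ(y, ŷ) = (y - ŷ)²`. -/
def sqLoss (y yhat : ℝ) : ℝ := (y - yhat) ^ 2

/-- The empirical loss `L_S(θ)` on the training set `S = ((x₁, y₁), …, (xₙ, yₙ))`. -/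
def empiricalLoss (φ : ℝ → ℝ) {L : ℕ} {m : ℕ → ℕ} {n : ℕ}
    (S : Fin n → EuclideanSpace ℝ (Fin (m 0)) × ℝ) (θ : Params L m) : ℝ :=
  1 / (n : ℝ) * ∑ i, sqLoss (S i).2 (predictor φ θ (S i).1)

/-- The population loss `L_D(θ)`, the expectation of the square loss under `D`. -/
def populationLoss (φ : ℝ → ℝ) {L : ℕ} {m : ℕ → ℕ}
    (D : Measure (EuclideanSpace ℝ (Fin (m 0)) × ℝ)) (θ : Params L m) : ℝ :=
  ∫ z, sqLoss z.2 (predictor φ θ z.1) ∂D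

/-- The activation function is twice differentiable with `|φ'| ≤ 1` (1-Lipschitz) and `|φ''| ≤ β`
(`β`-smooth). -/
structure ActivationAssumption (φ : ℝ → ℝ) (β : ℝ) : Prop where
  differentiable : Differentiable ℝ φ
  differentiable_deriv : Differentiable ℝ (deriv φ)
  abs_deriv_le : ∀ z, |deriv φ z| ≤ 1
  abs_deriv_deriv_le : ∀ z, |deriv (deriv φ) z| ≤ β

end WeightNorm

end

noncomputable section

namespace WeightNorm

/-! The proof bounds a Rademacher average by peeling off layers inside an exponential moment, which
costs a factor 2 per layer and nothing for the width. For fixed signs, the norm of a signed sum of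
layer outputs is at most `√q` times its largest coordinate, and `√q` cancels the normalization `1 /
√q`. A single vector of norm at most 1 remains (`exists_norm_sum_layer_le`). Contraction under `exp`
removes the activation, and splitting an absolute value into two signs gives the factor 2
(`ExpMomentLE.layer`). For the inputs, a Hilbert space estimate bounds the moment by `2 * exp (n c²
/ 2)`. Optimizing `c` gives order `√(n (L + 1))`. The square loss is `2 (2 + ρ₁)`-Lipschitz on the
relevant range, so a second contraction passes to the network outputs (`sum_sign_sqLoss_le`).
Symmetrization bounds the expected largest deviation, and bounded differences give the tail.
Measurability of suprema is secured by a countable dense set of parameters. Losses are bounded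
everywhere after truncating the data, which changes nothing almost surely. -/

/-! ### Sums over sign vectors. -/

/-- The real number `±1` of a sign. -/
def signVal (u : ℤˣ) : ℝ := ((u : ℤ) : ℝ)

@[simp] lemma signVal_one : signVal 1 = 1 := by simp [signVal]

@[simp] lemma signVal_neg (u : ℤˣ) : signVal (-u) = -signVal u := by simp [signVal]

lemma sum_sign {M : Type*} [AddCommMonoid M] (f : ℤˣ → M) : ∑ u, f u = f 1 + f (-1) := by
  rw [UnitsInt.univ, Finset.sum_pair (by decide)]

lemma sum_signs_succ {M : Type*} [AddCommMonoid M] {n : ℕ} (F : (Fin (n + 1) → ℤˣ) → M) :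
    ∑ ε, F ε = ∑ ε : Fin n → ℤˣ, (F (Fin.cons 1 ε) + F (Fin.cons (-1) ε)) := by
  rw [← (Fin.consEquiv fun _ : Fin (n + 1) => ℤˣ).sum_comp F, Fintype.sum_prod_type,
    Finset.sum_comm]
  exact Finset.sum_congr rfl fun ε _ => sum_sign _

lemma card_signs (n : ℕ) : Fintype.card (Fin n → ℤˣ) = 2 ^ n := by simp

/-! ### Contraction for Rademacher sums, linear and exponential. -/

section Contraction

variable {ι : Type*}

/-- The one-coordinate comparison from which contraction inequalities for Rademacher sums follow
by induction: `t` and `s` are the indices selected for the signs `1` and `-1`. -/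
def PairDominated (G : ℝ → ℝ) (u v : ι → ℝ) : Prop :=
  ∀ (A : ι → ℝ) (t s : ι), ∃ t' s',
    G (A t + u t) + G (A s - u s) ≤ G (A t' + v t') + G (A s' - v s')

/-- Comparison of Rademacher sums. The supremum over the index set is expressed by selectors
`T`, functions of the signs. -/
lemma exists_selector_sum_le {G : ℝ → ℝ} {n : ℕ} {u v : Fin n → ι → ℝ}
    (h : ∀ i, PairDominated G (u i) (v i)) (A : ι → ℝ) (T : (Fin n → ℤˣ) → ι) :
    ∃ T' : (Fin n → ℤˣ) → ι,
      ∑ ε, G (A (T ε) + ∑ i, signVal (ε i) * u i (T ε)) ≤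
        ∑ ε, G (A (T' ε) + ∑ i, signVal (ε i) * v i (T' ε)) := by
  induction n generalizing A with
  | zero => exact ⟨T, by simp⟩
  | succ n ih =>
    -- Fixing the first sign moves `± u 0` into the offset; this is why `A` must be arbitrary.
    obtain ⟨T₁, h₁⟩ := ih (fun i => h i.succ) (fun t => A t + u 0 t) fun ε => T (Fin.cons 1 ε)
    obtain ⟨T₂, h₂⟩ := ih (fun i => h i.succ) (fun t => A t - u 0 t) fun ε => T (Fin.cons (-1) ε)
    choose t' s' hts using fun ε : Fin n → ℤˣ =>
      h 0 (fun t => A t + ∑ i : Fin n, signVal (ε i) * v i.succ t) (T₁ ε) (T₂ ε)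
    refine ⟨fun ε => if ε 0 = 1 then t' (Fin.tail ε) else s' (Fin.tail ε), ?_⟩
    rw [sum_signs_succ, sum_signs_succ]
    have h3 := Finset.sum_le_sum fun ε (_ : ε ∈ Finset.univ) => hts ε
    simp only [Finset.sum_add_distrib] at h3 ⊢
    have hne : (-1 : ℤˣ) ≠ 1 := by decide
    simp only [Fin.sum_univ_succ, Fin.cons_zero, Fin.cons_succ, signVal_neg, signVal_one, one_mul,
      neg_mul, Fin.tail_cons, if_true, if_neg hne]
    simp only [sub_eq_add_neg, add_assoc] at h₁ h₂ h3 ⊢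
    simp only [add_comm, add_left_comm] at h₁ h₂ h3 ⊢
    linarith

/-- The offsets contribute `A t + A s` in either order, so exchanging `t` and `s` when `v t < v s`
turns the difference into its absolute value. -/
lemma pairDominated_id {u v : ι → ℝ} (h : ∀ t s, |u t - u s| ≤ |v t - v s|) :
    PairDominated id u v := by
  intro A t s
  have := (le_abs_self _).trans (h t s)
  rcases abs_cases (v t - v s) with ⟨h1, _⟩ | ⟨h1, _⟩
  · exact ⟨t, s, by simp only [id]; linarith⟩
  · exact ⟨s, t, by simp only [id]; linarith⟩

/-- Convexity: among pairs of a given sum, the more spread one has the larger sum of exponentials.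
Concretely, `(exp c - exp b) * (exp (a - b) - 1) ≥ 0`. -/
lemma exp_add_exp_le {a b c d : ℝ} (hca : b ≤ c) (hba : b ≤ a) (h : a + c ≤ d + b) :
    Real.exp a + Real.exp c ≤ Real.exp d + Real.exp b := by
  have h1 : Real.exp (c + (a - b)) ≤ Real.exp d := Real.exp_le_exp.2 (by linarith)
  have h2 : Real.exp a = Real.exp b * Real.exp (a - b) := by rw [← Real.exp_add]; ring_nf
  rw [Real.exp_add] at h1
  have h3 : 0 ≤ (Real.exp c - Real.exp b) * (Real.exp (a - b) - 1) :=
    mul_nonneg (sub_nonneg.2 (Real.exp_le_exp.2 hca))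
      (sub_nonneg.2 (Real.one_le_exp (by linarith)))
  rw [h2]
  nlinarith

/-- If `v t` and `v s` have opposite signs, each exponential can be increased separately, after an
exchange if necessary. If they have the same sign, one exponent may decrease, but the other gains at
least as much. Optimality of `t` and `s` makes the lowered exponent the smallest, so convexity
applies. -/
lemma pairDominated_exp {u v : ι → ℝ} (h0 : ∀ t, |u t| ≤ |v t|)
    (h : ∀ t s, |u t - u s| ≤ |v t - v s|) : PairDominated Real.exp u v := by
  intro A
  -- the case in which `t` and `s` are optimal for their signs
  have key : ∀ t s, A s + u s ≤ A t + u t → A t - u t ≤ A s - u s → ∃ t' s',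
      Real.exp (A t + u t) + Real.exp (A s - u s) ≤
        Real.exp (A t' + v t') + Real.exp (A s' - v s') := by
    intro t s h1 h2
    have ht := abs_le.1 (h0 t)
    have hs := abs_le.1 (h0 s)
    have hd := abs_le.1 (h t s)
    rcases le_total 0 (v t) with hvt | hvt <;> rcases le_total 0 (v s) with hvs | hvs
    · rw [abs_of_nonneg hvt] at ht
      rw [abs_of_nonneg hvs] at hs
      rcases le_total (v s) (v t) with hl | hl
      · rw [abs_of_nonneg (by linarith)] at hd
        refine ⟨t, s, ?_⟩
        have := @exp_add_exp_le (A s - u s) (A s - v s) (A t + u t) (A t + v t)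
          (by linarith) (by linarith) (by linarith)
        linarith
      · rw [abs_of_nonpos (by linarith)] at hd
        refine ⟨s, t, ?_⟩
        have := @exp_add_exp_le (A t + u t) (A t - v t) (A s - u s) (A s + v s)
          (by linarith) (by linarith) (by linarith)
        linarith
    · rw [abs_of_nonneg hvt] at ht
      rw [abs_of_nonpos hvs] at hs
      exact ⟨t, s, add_le_add (Real.exp_le_exp.2 (by linarith)) (Real.exp_le_exp.2 (by linarith))⟩
    · rw [abs_of_nonpos hvt] at ht
      rw [abs_of_nonneg hvs] at hs
      refine ⟨s, t, ?_⟩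
      rw [add_comm]
      exact add_le_add (Real.exp_le_exp.2 (by linarith)) (Real.exp_le_exp.2 (by linarith))
    · rw [abs_of_nonpos hvt] at ht
      rw [abs_of_nonpos hvs] at hs
      rcases le_total (v s) (v t) with hl | hl
      · rw [abs_of_nonneg (by linarith)] at hd
        refine ⟨t, s, ?_⟩
        have := @exp_add_exp_le (A t + u t) (A t + v t) (A s - u s) (A s - v s)
          (by linarith) (by linarith) (by linarith)
        linarith
      · rw [abs_of_nonpos (by linarith)] at hd
        refine ⟨s, t, ?_⟩
        have := @exp_add_exp_le (A s - u s) (A s + v s) (A t + u t) (A t - v t)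
          (by linarith) (by linarith) (by linarith)
        linarith
  intro t s
  -- Replacing each index by the better of the two for its sign only increases the left side, so
  -- `key` covers every case.
  rcases le_total (A s + u s) (A t + u t) with h1 | h1 <;>
    rcases le_total (A t - u t) (A s - u s) with h2 | h2
  · exact key t s h1 h2
  · obtain ⟨t', s', h'⟩ := key t t le_rfl le_rfl
    exact ⟨t', s', le_trans (by gcongr) h'⟩
  · obtain ⟨t', s', h'⟩ := key s s le_rfl le_rfl
    exact ⟨t', s', le_trans (by gcongr) h'⟩
  · obtain ⟨t', s', h'⟩ := key s t h1 h2
    exact ⟨t', s', le_trans (by gcongr) h'⟩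

end Contraction

/-! ### Exponential moments of signed sums in a Hilbert space. -/

section Hilbert

variable {E : Type*} [NormedAddCommGroup E] [InnerProductSpace ℝ E]

/-- The points `p ± t` are mirrored convex combinations of `p ± q`, which lie in `[0, ∞)`, where
powers are convex. -/
lemma add_pow_add_sub_pow_le {p q t : ℝ} (ht : |t| ≤ q) (hq : q ≤ p) (k : ℕ) :
    (p + t) ^ k + (p - t) ^ k ≤ (p + q) ^ k + (p - q) ^ k := by
  obtain ⟨ht1, ht2⟩ := abs_le.1 ht
  rcases ((abs_nonneg t).trans ht).eq_or_lt with h0 | h0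
  · have : t = 0 := by linarith
    simp [this, ← h0]
  have hc := (convexOn_pow (𝕜 := ℝ) k).2
  have ha : 0 ≤ (q + t) / (2 * q) := div_nonneg (by linarith) (by linarith)
  have hb : 0 ≤ (q - t) / (2 * q) := div_nonneg (by linarith) (by linarith)
  have hab : (q + t) / (2 * q) + (q - t) / (2 * q) = 1 := by field_simp; ring
  have hx : p + q ∈ Set.Ici (0 : ℝ) := Set.mem_Ici.2 (by linarith)
  have hy : p - q ∈ Set.Ici (0 : ℝ) := Set.mem_Ici.2 (by linarith)
  have h1 := hc hx hy ha hb hab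
  have h2 := hc hx hy hb ha (by rw [add_comm]; exact hab)
  simp only [smul_eq_mul] at h1 h2
  have e1 : (q + t) / (2 * q) * (p + q) + (q - t) / (2 * q) * (p - q) = p + t := by
    field_simp; ring
  have e2 : (q - t) / (2 * q) * (p + q) + (q + t) / (2 * q) * (p - q) = p - t := by
    field_simp; ring
  rw [e1] at h1
  rw [e2] at h2
  calc _ ≤ _ := add_le_add h1 h2
    _ = ((q + t) / (2 * q) + (q - t) / (2 * q)) * ((p + q) ^ k + (p - q) ^ k) := by ring
    _ = _ := by rw [hab, one_mul]

/-- Only even powers occur in the series of `cosh`, and `‖x ± y‖² = p ± t` with `p = ‖x‖² + ‖y‖²`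
and `t = 2⟪x, y⟫`. By Cauchy–Schwarz, `|t| ≤ 2‖x‖‖y‖ ≤ p`, so the series compare term by term. -/
lemma cosh_norm_add_add_cosh_norm_sub_le (x y : E) :
    Real.cosh ‖x + y‖ + Real.cosh ‖x - y‖ ≤ 2 * (Real.cosh ‖x‖ * Real.cosh ‖y‖) := by
  have e : 2 * (Real.cosh ‖x‖ * Real.cosh ‖y‖) =
      Real.cosh (‖x‖ + ‖y‖) + Real.cosh (‖x‖ - ‖y‖) := by
    rw [Real.cosh_add, Real.cosh_sub]; ring
  rw [e]
  refine hasSum_le (fun k => ?_)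
    ((Real.hasSum_cosh ‖x + y‖).add (Real.hasSum_cosh ‖x - y‖))
    ((Real.hasSum_cosh (‖x‖ + ‖y‖)).add (Real.hasSum_cosh (‖x‖ - ‖y‖)))
  rw [← add_div, ← add_div]
  refine div_le_div_of_nonneg_right ?_ (by positivity)
  rw [pow_mul, pow_mul, pow_mul, pow_mul, norm_add_sq_real, norm_sub_sq_real]
  have h := @add_pow_add_sub_pow_le (‖x‖ ^ 2 + ‖y‖ ^ 2) (2 * (‖x‖ * ‖y‖)) (2 * inner ℝ x y)
    (by rw [abs_mul, abs_two]; gcongr; exact abs_real_inner_le_norm x y)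
    (by nlinarith [sq_nonneg (‖x‖ - ‖y‖)]) k
  convert h using 2 <;> congr 1 <;> ring

lemma sum_cosh_norm_le {n : ℕ} (x : Fin n → E) :
    ∑ ε : Fin n → ℤˣ, Real.cosh ‖∑ i, signVal (ε i) • x i‖ ≤ 2 ^ n * ∏ i, Real.cosh ‖x i‖ := by
  induction n with
  | zero => simp
  | succ n ih =>
    rw [sum_signs_succ]
    simp only [Fin.sum_univ_succ, Fin.cons_zero, Fin.cons_succ, signVal_one, signVal_neg, one_smul,
      neg_smul, Fin.prod_univ_succ]
    calc _ ≤ ∑ ε : Fin n → ℤˣ, 2 * Real.cosh ‖x 0‖ *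
          Real.cosh ‖∑ i, signVal (ε i) • x i.succ‖ := by
          refine Finset.sum_le_sum fun ε _ => ?_
          have := cosh_norm_add_add_cosh_norm_sub_le (∑ i, signVal (ε i) • x (Fin.succ i)) (x 0)
          rw [add_comm (x 0), neg_add_eq_sub]
          linarith
      _ ≤ 2 * Real.cosh ‖x 0‖ * (2 ^ n * ∏ i : Fin n, Real.cosh ‖x i.succ‖) := by
          rw [← Finset.mul_sum]
          exact mul_le_mul_of_nonneg_left (ih _) (by positivity)
      _ = _ := by ring

/-- Uses `exp s ≤ 2 cosh s`, the source of the leading 2, and `cosh s ≤ exp (s² / 2)`. -/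
lemma sum_exp_norm_le {n : ℕ} {x : Fin n → E} (hx : ∀ i, ‖x i‖ ≤ 1) {c : ℝ} (hc : 0 ≤ c) :
    ∑ ε : Fin n → ℤˣ, Real.exp (c * ‖∑ i, signVal (ε i) • x i‖) ≤
      2 ^ n * (2 * Real.exp (n * c ^ 2 / 2)) := by
  have h1 := sum_cosh_norm_le fun i => c • x i
  have h2 : ∏ i, Real.cosh ‖c • x i‖ ≤ Real.exp (n * c ^ 2 / 2) := by
    calc _ ≤ ∏ _i : Fin n, Real.exp (c ^ 2 / 2) := by
          refine Finset.prod_le_prod (fun i _ => (Real.cosh_pos _).le) fun i _ => ?_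
          refine (Real.cosh_le_exp_half_sq _).trans (Real.exp_le_exp.2 ?_)
          have : ‖c • x i‖ ≤ c := by
            rw [norm_smul, Real.norm_of_nonneg hc]
            exact mul_le_of_le_one_right hc (hx i)
          gcongr
      _ = _ := by
          rw [Finset.prod_const, Finset.card_univ, Fintype.card_fin, ← Real.exp_nat_mul]
          ring_nf
  have h3 : ∀ ε : Fin n → ℤˣ, Real.exp (c * ‖∑ i, signVal (ε i) • x i‖) ≤
      2 * Real.cosh ‖∑ i, signVal (ε i) • c • x i‖ := by
    intro ε
    have : ‖∑ i, signVal (ε i) • c • x i‖ = c * ‖∑ i, signVal (ε i) • x i‖ := by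
      simp only [smul_comm _ c]
      rw [← Finset.smul_sum, norm_smul, Real.norm_of_nonneg hc]
    rw [this, Real.cosh_eq]
    have := Real.exp_pos (-(c * ‖∑ i, signVal (ε i) • x i‖))
    linarith
  calc _ ≤ _ := Finset.sum_le_sum fun ε _ => h3 ε
    _ ≤ 2 * (2 ^ n * Real.exp (n * c ^ 2 / 2)) := by
        rw [← Finset.mul_sum]
        gcongr
        exact h1.trans (by gcongr)
    _ = _ := by ring

end Hilbert

/-! ### Peeling the layers and the loss. -/

lemma ActivationAssumption.abs_sub_le {φ : ℝ → ℝ} {β : ℝ} (hφ : ActivationAssumption φ β)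
    (s t : ℝ) : |φ s - φ t| ≤ |s - t| := by
  have := convex_univ.norm_image_sub_le_of_norm_deriv_le (f := φ) (C := 1)
    (fun z _ => hφ.differentiable z) (fun z _ => hφ.abs_deriv_le z) (Set.mem_univ t)
    (Set.mem_univ s)
  simpa using this

lemma norm_inv_norm_smul_le_one {E : Type*} [NormedAddCommGroup E] [NormedSpace ℝ E] (w : E) :
    ‖‖w‖⁻¹ • w‖ ≤ 1 := by
  rw [norm_smul, norm_inv, norm_norm]
  exact inv_mul_le_one

/-- The rescaled activation function `√q φ(· / √q)`. -/
def rescaled (φ : ℝ → ℝ) (q : ℕ) (s : ℝ) : ℝ := √(q : ℝ) * φ (1 / √(q : ℝ) * s)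

section Layers

variable {φ : ℝ → ℝ}

lemma abs_rescaled_sub_le (hφ : ∀ s t, |φ s - φ t| ≤ |s - t|) (q : ℕ) (s t : ℝ) :
    |rescaled φ q s - rescaled φ q t| ≤ |s - t| := by
  rw [rescaled, rescaled, ← mul_sub, abs_mul, abs_of_nonneg (Real.sqrt_nonneg _)]
  calc _ ≤ √(q : ℝ) * |1 / √(q : ℝ) * s - 1 / √(q : ℝ) * t| :=
        mul_le_mul_of_nonneg_left (hφ _ _) (Real.sqrt_nonneg _)
    _ = √(q : ℝ) * (√(q : ℝ))⁻¹ * |s - t| := by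
        rw [← mul_sub, abs_mul, abs_of_nonneg (by positivity), one_div, mul_assoc]
    -- Only an inequality, since the product is `0` when `q = 0`.
    _ ≤ 1 * |s - t| := by gcongr; exact mul_inv_le_one
    _ = _ := one_mul _

lemma rescaled_zero (hφ0 : φ 0 = 0) (q : ℕ) : rescaled φ q 0 = 0 := by simp [rescaled, hφ0]

lemma norm_le_sqrt_mul_of_forall_le {q : ℕ} (z : EuclideanSpace ℝ (Fin q)) {B : ℝ} (hB : 0 ≤ B)
    (h : ∀ j, |z j| ≤ B) : ‖z‖ ≤ √(q : ℝ) * B := by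
  rw [EuclideanSpace.norm_eq]
  refine Real.sqrt_le_iff.2 ⟨by positivity, ?_⟩
  rw [mul_pow, Real.sq_sqrt (Nat.cast_nonneg _)]
  calc _ ≤ ∑ _j : Fin q, B ^ 2 := by
        refine Finset.sum_le_sum fun j _ => ?_
        gcongr
        exact h j
    _ = _ := by simp

lemma norm_layer_le (hφ : ∀ s t, |φ s - φ t| ≤ |s - t|) (hφ0 : φ 0 = 0) {p q : ℕ}
    (w : Fin q → EuclideanSpace ℝ (Fin p)) (a : EuclideanSpace ℝ (Fin p)) :
    ‖layer φ w a‖ ≤ ‖a‖ := by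
  have h1 : ∀ j, |layer φ w a j| ≤ 1 / √(q : ℝ) * ‖a‖ := by
    intro j
    have h2 : |φ (1 / √(q : ℝ) * inner ℝ (‖w j‖⁻¹ • w j) a)| ≤
        |1 / √(q : ℝ) * inner ℝ (‖w j‖⁻¹ • w j) a| := by
      simpa only [hφ0, sub_zero] using hφ (1 / √(q : ℝ) * inner ℝ (‖w j‖⁻¹ • w j) a) 0
    refine h2.trans ?_
    rw [abs_mul, abs_of_nonneg (by positivity)]
    gcongr
    refine (abs_real_inner_le_norm _ _).trans ?_
    exact mul_le_of_le_one_left (norm_nonneg _) (norm_inv_norm_smul_le_one _)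
  refine (norm_le_sqrt_mul_of_forall_le _ (by positivity) h1).trans ?_
  rw [← mul_assoc, mul_one_div]
  exact mul_le_of_le_one_left (norm_nonneg _) (div_self_le_one _)

lemma norm_activation_le (hφ : ∀ s t, |φ s - φ t| ≤ |s - t|) (hφ0 : φ 0 = 0) {L : ℕ} {m : ℕ → ℕ}
    (θ : Params L m) (x : EuclideanSpace ℝ (Fin (m 0))) (l : ℕ) (hl : l ≤ L) :
    ‖activation φ θ x l hl‖ ≤ ‖x‖ := by
  induction l with
  | zero => exact le_rfl
  | succ l ih => exact (norm_layer_le hφ hφ0 _ _).trans (ih _)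

lemma abs_predictor_le (hφ : ∀ s t, |φ s - φ t| ≤ |s - t|) (hφ0 : φ 0 = 0) {L : ℕ} {m : ℕ → ℕ}
    {θ : Params L m} {R : ℝ} (hθ : ‖θ.v‖ ≤ R) {x : EuclideanSpace ℝ (Fin (m 0))} (hx : ‖x‖ ≤ 1) :
    |predictor φ θ x| ≤ R := by
  refine (abs_real_inner_le_norm _ _).trans ?_
  have h := (norm_activation_le hφ hφ0 θ x L le_rfl).trans hx
  exact (mul_le_of_le_one_right (norm_nonneg _) h).trans hθ

/-- The neuron attaining the largest coordinate provides `w'`. It depends on the weights `σ`, which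
is why later bounds allow selectors. This is where the width disappears. -/
lemma exists_norm_sum_layer_le {n p q : ℕ}
    (w : Fin q → EuclideanSpace ℝ (Fin p)) (a : Fin n → EuclideanSpace ℝ (Fin p))
    (σ : Fin n → ℝ) :
    ∃ w' : EuclideanSpace ℝ (Fin p), ‖w'‖ ≤ 1 ∧
      ‖∑ i, σ i • layer φ w (a i)‖ ≤ |∑ i, σ i * rescaled φ q (inner ℝ w' (a i))| := by
  rcases Nat.eq_zero_or_pos q with rfl | hq
  · refine ⟨0, by simp, ?_⟩
    rw [Subsingleton.elim (∑ i, σ i • layer φ w (a i)) 0, norm_zero]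
    exact abs_nonneg _
  · have : Nonempty (Fin q) := ⟨⟨0, hq⟩⟩
    obtain ⟨j, hj⟩ := Finite.exists_max fun j => |(∑ i, σ i • layer φ w (a i)) j|
    refine ⟨‖w j‖⁻¹ • w j, norm_inv_norm_smul_le_one _, ?_⟩
    refine (norm_le_sqrt_mul_of_forall_le _ (abs_nonneg _) hj).trans (le_of_eq ?_)
    rw [← abs_of_nonneg (Real.sqrt_nonneg (q : ℝ)), ← abs_mul]
    congr 1
    simp only [WithLp.ofLp_sum, WithLp.ofLp_smul, Finset.sum_apply, Pi.smul_apply, smul_eq_mul,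
      layer, rescaled, Finset.mul_sum]
    exact Finset.sum_congr rfl fun i _ => by ring

/-- The exponential moment of the norm of Rademacher sums, uniformly over the tuples in `𝒜`, is at
most `C` (up to normalization by the number of signs). The tuple may depend on the signs. -/
def ExpMomentLE {n : ℕ} {E : Type*} [NormedAddCommGroup E] [NormedSpace ℝ E]
    (𝒜 : Set (Fin n → E)) (c C : ℝ) : Prop :=
  ∀ T : (Fin n → ℤˣ) → Fin n → E, (∀ ε, T ε ∈ 𝒜) →
    ∑ ε, Real.exp (c * ‖∑ i, signVal (ε i) • T ε i‖) ≤ C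

/-- After reduction to one neuron, `exp |s| ≤ exp s + exp (-s)`. Each half loses the activation by
contraction and then its weight vector by Cauchy–Schwarz, leaving the moment of the previous layer.
-/
lemma ExpMomentLE.layer (hφ : ∀ s t, |φ s - φ t| ≤ |s - t|) (hφ0 : φ 0 = 0) {n p q : ℕ}
    {𝒜 : Set (Fin n → EuclideanSpace ℝ (Fin p))} {c C : ℝ} (hc : 0 ≤ c)
    (h : ExpMomentLE 𝒜 c C) :
    ExpMomentLE {b | ∃ a ∈ 𝒜, ∃ w : Fin q → EuclideanSpace ℝ (Fin p),
      b = fun i => WeightNorm.layer φ w (a i)} c (2 * C) := by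
  intro T hT
  choose a ha w hw using hT
  choose w' hw' hle using fun ε : Fin n → ℤˣ =>
    exists_norm_sum_layer_le (φ := φ) (w ε) (a ε) fun i => signVal (ε i)
  let ι := 𝒜 × {w : EuclideanSpace ℝ (Fin p) // ‖w‖ ≤ 1}
  let v : Fin n → ι → ℝ := fun i t => c * inner ℝ (t.2 : EuclideanSpace ℝ (Fin p)) (t.1.1 i)
  let u : Fin n → ι → ℝ := fun i t =>
    c * rescaled φ q (inner ℝ (t.2 : EuclideanSpace ℝ (Fin p)) (t.1.1 i))
  have hpair : ∀ i, PairDominated Real.exp (u i) (v i) := by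
    intro i
    have h1 : ∀ t s, |u i t - u i s| ≤ |v i t - v i s| := by
      intro t s
      simp only [u, v]
      rw [← mul_sub, ← mul_sub, abs_mul, abs_mul]
      exact mul_le_mul_of_nonneg_left (abs_rescaled_sub_le hφ q _ _) (abs_nonneg c)
    refine pairDominated_exp (fun t => ?_) h1
    simp only [u, v]
    rw [abs_mul, abs_mul]
    refine mul_le_mul_of_nonneg_left ?_ (abs_nonneg c)
    simpa [rescaled_zero hφ0] using
      abs_rescaled_sub_le hφ q (inner ℝ (t.2 : EuclideanSpace ℝ (Fin p)) (t.1.1 i)) 0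
  have half : ∀ U : (Fin n → ℤˣ) → ι,
      ∑ ε, Real.exp (∑ i, signVal (ε i) * u i (U ε)) ≤ C := by
    intro U
    obtain ⟨U', hU'⟩ := exists_selector_sum_le hpair (fun _ => 0) U
    simp only [zero_add] at hU'
    refine hU'.trans (le_trans (Finset.sum_le_sum fun ε _ => Real.exp_le_exp.2 ?_)
      (h (fun ε => (U' ε).1.1) fun ε => (U' ε).1.2))
    have e : ∑ i, signVal (ε i) * v i (U' ε) = c * inner ℝ ((U' ε).2 : EuclideanSpace ℝ (Fin p))
        (∑ i, signVal (ε i) • (U' ε).1.1 i) := by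
      simp only [v, inner_sum, inner_smul_right, Finset.mul_sum]
      exact Finset.sum_congr rfl fun i _ => by ring
    rw [e]
    gcongr
    refine (real_inner_le_norm _ _).trans ?_
    exact mul_le_of_le_one_left (norm_nonneg _) (U' ε).2.2
  let U : (Fin n → ℤˣ) → ι := fun ε => (⟨a ε, ha ε⟩, ⟨w' ε, hw' ε⟩)
  -- Flipping all signs turns this into `half` for the selector `U (-ε)`.
  have hneg : ∑ ε, Real.exp (-∑ i, signVal (ε i) * u i (U ε)) ≤ C := by
    have := half fun ε => U (-ε)
    rw [← Equiv.sum_comp (Equiv.neg (Fin n → ℤˣ))] at this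
    simpa only [Equiv.neg_apply, Pi.neg_apply, signVal_neg, neg_neg, neg_mul,
      Finset.sum_neg_distrib] using this
  have hpos := half U
  calc _ ≤ ∑ ε, (Real.exp (∑ i, signVal (ε i) * u i (U ε)) +
        Real.exp (-∑ i, signVal (ε i) * u i (U ε))) := by
        refine Finset.sum_le_sum fun ε _ => ?_
        have h1 : c * ‖∑ i, signVal (ε i) • T ε i‖ ≤ |∑ i, signVal (ε i) * u i (U ε)| := by
          have e : ∑ i, signVal (ε i) * u i (U ε) =
              c * ∑ i, signVal (ε i) * rescaled φ q (inner ℝ (w' ε) (a ε i)) := by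
            simp only [u, U, Finset.mul_sum]
            exact Finset.sum_congr rfl fun i _ => by ring
          rw [e, abs_mul, abs_of_nonneg hc]
          gcongr
          have := hle ε
          simpa only [hw ε] using this
        refine (Real.exp_le_exp.2 h1).trans ?_
        rcases abs_cases (∑ i, signVal (ε i) * u i (U ε)) with ⟨e, _⟩ | ⟨e, _⟩ <;> rw [e]
        · exact le_add_of_nonneg_right (Real.exp_pos _).le
        · exact le_add_of_nonneg_left (Real.exp_pos _).le
    _ ≤ 2 * C := by rw [Finset.sum_add_distrib]; linarith

lemma expMomentLE_activation (hφ : ∀ s t, |φ s - φ t| ≤ |s - t|) (hφ0 : φ 0 = 0) {n L : ℕ}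
    {m : ℕ → ℕ} {x : Fin n → EuclideanSpace ℝ (Fin (m 0))} (hx : ∀ i, ‖x i‖ ≤ 1) {c : ℝ}
    (hc : 0 ≤ c) (l : ℕ) (hl : l ≤ L) :
    ExpMomentLE {b | ∃ θ : Params L m, b = fun i => activation φ θ (x i) l hl} c
      (2 ^ l * (2 ^ n * (2 * Real.exp (n * c ^ 2 / 2)))) := by
  induction l with
  | zero =>
    intro T hT
    choose θ hθ using hT
    simp only [hθ, pow_zero, one_mul]
    exact sum_exp_norm_le hx hc
  | succ l ih =>
    intro T hT
    rw [pow_succ', mul_assoc]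
    refine (ih (Nat.le_of_succ_le hl)).layer hφ hφ0 hc T fun ε => ?_
    obtain ⟨θ, hθ⟩ := hT ε
    exact ⟨_, ⟨θ, rfl⟩, θ.W ⟨l, hl⟩, hθ⟩

lemma sum_norm_activation_le (hφ : ∀ s t, |φ s - φ t| ≤ |s - t|) (hφ0 : φ 0 = 0) {n L : ℕ}
    (hn : 1 ≤ n) {m : ℕ → ℕ} {x : Fin n → EuclideanSpace ℝ (Fin (m 0))} (hx : ∀ i, ‖x i‖ ≤ 1)
    (θ : (Fin n → ℤˣ) → Params L m) :
    ∑ ε, ‖∑ i, signVal (ε i) • activation φ (θ ε) (x i) L le_rfl‖ ≤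
      2 ^ n * (√n * √(2 * Real.log 2 * (L + 1))) := by
  have hn' : (0 : ℝ) < n := by exact_mod_cast hn
  have hlog : 0 < Real.log 2 := Real.log_pos one_lt_two
  -- This `c` balances `(L + 1) log 2` with `n c² / 2`, so the moment bound becomes `2 ^ n * exp (n
  -- c²)`.
  set c := √(2 * Real.log 2 * (L + 1)) / √n with hc_def
  have hc : 0 < c := by positivity
  have hc2 : n * c ^ 2 = 2 * Real.log 2 * (L + 1) := by
    rw [hc_def, div_pow, Real.sq_sqrt (by positivity), Real.sq_sqrt hn'.le]
    field_simp
  set K : ℝ := n * c ^ 2 with hK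
  have h1 := expMomentLE_activation hφ hφ0 hx hc.le L le_rfl
    (fun ε i => activation φ (θ ε) (x i) L le_rfl) fun ε => ⟨θ ε, rfl⟩
  have h2 : (2 : ℝ) ^ L * (2 ^ n * (2 * Real.exp (n * c ^ 2 / 2))) = 2 ^ n * Real.exp K := by
    have e1 : (2 : ℝ) ^ (L + 1) = Real.exp (K / 2) := by
      rw [← Real.rpow_natCast, Real.rpow_def_of_pos two_pos, hc2]
      push_cast
      ring_nf
    have e2 : Real.exp K = Real.exp (K / 2) * Real.exp (K / 2) := by
      rw [← Real.exp_add]; ring_nf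
    rw [e2, ← hK]
    nth_rw 2 [← e1]
    ring
  rw [h2] at h1
  set Y : (Fin n → ℤˣ) → ℝ := fun ε =>
    ‖∑ i, signVal (ε i) • activation φ (θ ε) (x i) L le_rfl‖
  -- The tangent to `exp` at `K` replaces Jensen's inequality.
  have h3 : ∀ ε, c * Y ε ≤ Real.exp (-K) * Real.exp (c * Y ε) + (K - 1) := by
    intro ε
    have := Real.add_one_le_exp (-K + c * Y ε)
    rw [Real.exp_add] at this
    linarith
  have h4 : c * ∑ ε, Y ε ≤ 2 ^ n * K := by
    rw [Finset.mul_sum]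
    calc _ ≤ _ := Finset.sum_le_sum fun ε _ => h3 ε
      _ = Real.exp (-K) * ∑ ε, Real.exp (c * Y ε) + 2 ^ n * (K - 1) := by
          rw [Finset.sum_add_distrib, ← Finset.mul_sum, Finset.sum_const, Finset.card_univ,
            card_signs, nsmul_eq_mul]
          push_cast
          rfl
      _ ≤ Real.exp (-K) * (2 ^ n * Real.exp K) + 2 ^ n * (K - 1) := by gcongr
      _ = 2 ^ n * (Real.exp (-K) * Real.exp K) + 2 ^ n * (K - 1) := by ring
      _ = 2 ^ n * K := by rw [← Real.exp_add, neg_add_cancel, Real.exp_zero]; ring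
  have h5 : √n * √(2 * Real.log 2 * (L + 1)) = n * c := by
    rw [hc_def]
    nth_rw 2 [← Real.mul_self_sqrt hn'.le]
    field_simp
  rw [h5]
  refine le_of_mul_le_mul_left (h4.trans (le_of_eq ?_)) hc
  rw [hK]
  ring

lemma sqrt_two_log_two_mul_succ_le {L : ℕ} (hL : 1 ≤ L) :
    √(2 * Real.log 2 * (L + 1)) ≤ √(2 * Real.log 2 * L) + 1 := by
  have hL' : (1 : ℝ) ≤ L := by exact_mod_cast hL
  have h1 := Real.log_two_gt_d9
  have h2 := Real.log_two_lt_d9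
  refine Real.sqrt_le_iff.2 ⟨by positivity, ?_⟩
  have h3 : 1 ≤ √(2 * Real.log 2 * L) := Real.one_le_sqrt.2 (by nlinarith)
  have h4 : √(2 * Real.log 2 * L) ^ 2 = 2 * Real.log 2 * L := Real.sq_sqrt (by positivity)
  nlinarith

/-- With `|y| ≤ 1` and predictions bounded by `R`, the loss is `2 (1 + R)`-Lipschitz in the
prediction. The output layer then costs `R` by Cauchy–Schwarz. -/
lemma sum_sign_sqLoss_le (hφ : ∀ s t, |φ s - φ t| ≤ |s - t|) (hφ0 : φ 0 = 0) {n L : ℕ}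
    (hn : 1 ≤ n) (hL : 1 ≤ L) {m : ℕ → ℕ} {R : ℝ} (hR : 0 ≤ R)
    {x : Fin n → EuclideanSpace ℝ (Fin (m 0))} (hx : ∀ i, ‖x i‖ ≤ 1)
    {y : Fin n → ℝ} (hy : ∀ i, |y i| ≤ 1) (T : (Fin n → ℤˣ) → {θ : Params L m // ‖θ.v‖ ≤ R}) :
    ∑ ε, ∑ i, signVal (ε i) * sqLoss (y i) (predictor φ (T ε).1 (x i)) ≤
      2 ^ n * (2 * (1 + R) * R * (√n * (√(2 * Real.log 2 * L) + 1))) := by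
  let u : Fin n → {θ : Params L m // ‖θ.v‖ ≤ R} → ℝ := fun i θ =>
    sqLoss (y i) (predictor φ θ.1 (x i))
  let v : Fin n → {θ : Params L m // ‖θ.v‖ ≤ R} → ℝ := fun i θ =>
    2 * (1 + R) * predictor φ θ.1 (x i)
  have hpair : ∀ i, PairDominated id (u i) (v i) := by
    refine fun i => pairDominated_id fun θ θ' => ?_
    have h1 := abs_predictor_le hφ hφ0 θ.2 (hx i)
    have h2 := abs_predictor_le hφ hφ0 θ'.2 (hx i)
    simp only [u, v, sqLoss]
    rw [← mul_sub, abs_mul, abs_of_nonneg (by positivity : 0 ≤ 2 * (1 + R))]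
    have e : (y i - predictor φ θ.1 (x i)) ^ 2 - (y i - predictor φ θ'.1 (x i)) ^ 2 =
        (predictor φ θ.1 (x i) + predictor φ θ'.1 (x i) - 2 * y i) *
          (predictor φ θ.1 (x i) - predictor φ θ'.1 (x i)) := by ring
    rw [e, abs_mul]
    gcongr
    have h3 := abs_le.1 (hy i)
    rw [abs_le] at h1 h2 ⊢
    constructor <;> linarith [h1.1, h1.2, h2.1, h2.2, h3.1, h3.2]
  obtain ⟨T', hT'⟩ := exists_selector_sum_le hpair (fun _ => 0) T
  simp only [zero_add, id] at hT'
  refine hT'.trans ?_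
  have h1 : ∀ ε, ∑ i, signVal (ε i) * v i (T' ε) ≤
      2 * (1 + R) * R * ‖∑ i, signVal (ε i) • activation φ (T' ε).1 (x i) L le_rfl‖ := by
    intro ε
    have e : ∑ i, signVal (ε i) * v i (T' ε) = 2 * (1 + R) * inner ℝ (T' ε).1.v
        (∑ i, signVal (ε i) • activation φ (T' ε).1 (x i) L le_rfl) := by
      simp only [v, predictor, inner_sum, inner_smul_right, Finset.mul_sum]
      exact Finset.sum_congr rfl fun i _ => by ring
    rw [e, mul_assoc (2 * (1 + R))]
    gcongr
    refine (real_inner_le_norm _ _).trans ?_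
    gcongr
    exact (T' ε).2
  refine (Finset.sum_le_sum fun ε _ => h1 ε).trans ?_
  rw [← Finset.mul_sum]
  calc _ ≤ 2 * (1 + R) * R * (2 ^ n * (√n * √(2 * Real.log 2 * (L + 1)))) := by
        gcongr
        exact sum_norm_activation_le hφ hφ0 hn hx _
    _ ≤ 2 * (1 + R) * R * (2 ^ n * (√n * (√(2 * Real.log 2 * L) + 1))) := by
        gcongr
        exact sqrt_two_log_two_mul_succ_le hL
    _ = _ := by ring

end Layers

/-! ### Concentration for functions with bounded differences. -/

section Probability

variable {Z : Type*} [MeasurableSpace Z]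

lemma integral_comp_of_measurePreserving {X Y : Type*} [MeasurableSpace X] [MeasurableSpace Y]
    {μ : Measure X} {ν : Measure Y} {g : X → Y} (hg : MeasurePreserving g μ ν) {f : Y → ℝ}
    (hf : Measurable f) : ∫ x, f (g x) ∂μ = ∫ y, f y ∂ν := by
  rw [← hg.map_eq, integral_map hg.aemeasurable hf.aestronglyMeasurable]

lemma integrable_of_abs_le {X : Type*} [MeasurableSpace X] {μ : Measure X} [IsFiniteMeasure μ]
    {f : X → ℝ} (hf : Measurable f) {B : ℝ} (hB : ∀ x, |f x| ≤ B) : Integrable f μ :=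
  Integrable.of_bound hf.aestronglyMeasurable B (.of_forall hB)

lemma abs_integral_le_of_abs_le {X : Type*} [MeasurableSpace X] (μ : Measure X)
    [IsProbabilityMeasure μ] {f : X → ℝ} {B : ℝ} (hB : ∀ x, |f x| ≤ B) : |∫ x, f x ∂μ| ≤ B := by
  have h : ∀ x, ‖f x‖ ≤ B := hB
  simpa using norm_integral_le_of_norm_le_const (μ := μ) (.of_forall h)

lemma measurable_cons {n : ℕ} :
    Measurable fun p : Z × (Fin n → Z) => (Fin.cons p.1 p.2 : Fin (n + 1) → Z) := by
  refine measurable_pi_lambda _ fun i => ?_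
  refine Fin.cases ?_ (fun j => ?_) i
  · simpa using measurable_fst
  · simp only [Fin.cons_succ]
    exact (measurable_pi_apply j).comp measurable_snd

lemma integral_pi_succ (D : Measure Z) [IsProbabilityMeasure D] {n : ℕ}
    {f : (Fin (n + 1) → Z) → ℝ} (hf : Measurable f) {B : ℝ} (hB : ∀ S, |f S| ≤ B) :
    ∫ S, f S ∂(Measure.pi fun _ => D) =
      ∫ S, ∫ z, f (Fin.cons z S) ∂D ∂(Measure.pi fun _ : Fin n => D) := by
  have h := (measurePreserving_piFinSuccAbove (fun _ : Fin (n + 1) => D) 0).symm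
  have e : ∀ p : Z × (Fin n → Z),
      (MeasurableEquiv.piFinSuccAbove (fun _ : Fin (n + 1) => Z) 0).symm p = Fin.cons p.1 p.2 :=
    fun p => by simp [MeasurableEquiv.piFinSuccAbove]; rfl
  rw [← integral_comp_of_measurePreserving h hf]
  simp only [e]
  exact integral_prod_symm _ (integrable_of_abs_le (hf.comp measurable_cons) fun p => hB _)

/-- An exponential moment bound for functions with bounded differences of independent variables. -/
lemma integral_exp_le_of_bounded_differences (D : Measure Z) [IsProbabilityMeasure D] {c : ℝ}
    (hc : 0 ≤ c) (r : ℝ) {n : ℕ} {f : (Fin n → Z) → ℝ} (hf : Measurable f) {B : ℝ}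
    (hB : ∀ S, |f S| ≤ B) (hd : ∀ S i z, |f (Function.update S i z) - f S| ≤ c) :
    ∫ S, Real.exp (r * (f S - ∫ S', f S' ∂(Measure.pi fun _ => D))) ∂(Measure.pi fun _ => D) ≤
      Real.exp (n * c ^ 2 * r ^ 2 / 2) := by
  induction n with
  | zero =>
    have : ∀ S : Fin 0 → Z, f S = f Fin.elim0 := fun S => by rw [Subsingleton.elim S Fin.elim0]
    simp [this]
  | succ n ih =>
    -- Averaging out the first variable preserves the bounded differences, so the induction applies
    -- to `g`.
    let g : (Fin n → Z) → ℝ := fun S => ∫ z, f (Fin.cons z S) ∂D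
    have hfc : Measurable fun p : (Fin n → Z) × Z => f (Fin.cons p.2 p.1) :=
      hf.comp (measurable_cons.comp measurable_swap)
    have hg : Measurable g := (hfc.stronglyMeasurable.integral_prod_right).measurable
    have hfz : ∀ S : Fin n → Z, Measurable fun z => f (Fin.cons z S) := fun S =>
      hfc.comp measurable_prodMk_left
    have hfi : ∀ S : Fin n → Z, Integrable (fun z => f (Fin.cons z S)) D := fun S =>
      integrable_of_abs_le (hfz S) fun z => hB _
    have hgB : ∀ S, |g S| ≤ B := fun S =>
      abs_integral_le_of_abs_le D fun z => hB _
    have hgd : ∀ S i z, |g (Function.update S i z) - g S| ≤ c := by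
      intro S i z
      simp only [g]
      rw [← integral_sub (hfi _) (hfi _)]
      refine abs_integral_le_of_abs_le D fun y => ?_
      rw [Fin.cons_update]
      exact hd _ _ _
    have hEg : ∫ S, f S ∂(Measure.pi fun _ => D) = ∫ S, g S ∂(Measure.pi fun _ => D) :=
      integral_pi_succ D hf hB
    have hin : ∀ S : Fin n → Z,
        ∫ z, Real.exp (r * (f (Fin.cons z S) - g S)) ∂D ≤ Real.exp (c ^ 2 * r ^ 2 / 2) := by
      intro S
      -- An interval of length `2c` around the mean; Hoeffding's lemma then gives variance proxy
      -- `c²`.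
      have hX : ∀ z, f (Fin.cons z S) ∈ Set.Icc (g S - c) (g S + c) := by
        intro z
        have h2 : |∫ y, (f (Fin.cons z S) - f (Fin.cons y S)) ∂D| ≤ c := by
          refine abs_integral_le_of_abs_le D fun y => ?_
          have := hd (Fin.cons y S) 0 z
          rwa [Fin.update_cons_zero] at this
        rw [integral_sub (integrable_const (μ := D) _) (hfi S)] at h2
        simp only [integral_const, probReal_univ (μ := D), one_smul] at h2
        have := abs_le.1 h2
        constructor <;> simp only [g] <;> linarith [this.1, this.2]
      have h3 := (ProbabilityTheory.hasSubgaussianMGF_of_mem_Icc (μ := D) (hfz S).aemeasurable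
        (.of_forall hX)).mgf_le r
      have e : (((‖g S + c - (g S - c)‖₊ / 2) ^ 2 : NNReal) : ℝ) = c ^ 2 := by
        push_cast
        rw [Real.norm_of_nonneg (by linarith)]
        ring
      rwa [e] at h3
    set a := ∫ S, g S ∂(Measure.pi fun _ : Fin n => D) with ha
    have haB : |a| ≤ B := abs_integral_le_of_abs_le _ hgB
    have hexpB : ∀ y, |y| ≤ B → |Real.exp (r * (y - a))| ≤ Real.exp (|r| * (B + B)) := by
      intro y hy
      rw [abs_of_pos (Real.exp_pos _), Real.exp_le_exp]
      refine (le_abs_self _).trans ?_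
      rw [abs_mul]
      gcongr
      exact (abs_sub _ _).trans (add_le_add hy haB)
    have hfm : Measurable fun S => Real.exp (r * (f S - a)) :=
      Real.measurable_exp.comp ((hf.sub_const _).const_mul r)
    rw [hEg, integral_pi_succ D hfm fun S => hexpB _ (hB S)]
    have hsplit : ∀ S : Fin n → Z, ∫ z, Real.exp (r * (f (Fin.cons z S) - a)) ∂D ≤
        Real.exp (c ^ 2 * r ^ 2 / 2) * Real.exp (r * (g S - a)) := by
      intro S
      have e : ∀ z, Real.exp (r * (f (Fin.cons z S) - a)) =
          Real.exp (r * (f (Fin.cons z S) - g S)) * Real.exp (r * (g S - a)) := fun z => by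
        rw [← Real.exp_add]; ring_nf
      simp only [e]
      rw [integral_mul_const]
      gcongr
      exact hin S
    have hint : Integrable (fun S => Real.exp (r * (g S - a))) (Measure.pi fun _ : Fin n => D) :=
      integrable_of_abs_le (Real.measurable_exp.comp ((hg.sub_const _).const_mul r))
        fun S => hexpB _ (hgB S)
    calc _ ≤ ∫ S, Real.exp (c ^ 2 * r ^ 2 / 2) * Real.exp (r * (g S - a))
          ∂(Measure.pi fun _ : Fin n => D) :=
          integral_mono_of_nonneg (.of_forall fun S => integral_nonneg fun z => (Real.exp_pos _).le)
            (hint.const_mul _) (.of_forall hsplit)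
      _ ≤ Real.exp (c ^ 2 * r ^ 2 / 2) * Real.exp (n * c ^ 2 * r ^ 2 / 2) := by
          rw [integral_const_mul]
          gcongr
          exact ih hg hgB hgd
      _ = _ := by
          rw [← Real.exp_add]
          push_cast
          ring_nf

/-- Chernoff's bound with proxy `n c²`. The exponent is a quarter of McDiarmid's, which suffices
here. -/
lemma measureReal_ge_le_of_bounded_differences (D : Measure Z) [IsProbabilityMeasure D] {n : ℕ}
    (hn : 1 ≤ n) {f : (Fin n → Z) → ℝ} (hf : Measurable f) {B c : ℝ} (hc : 0 < c)
    (hB : ∀ S, |f S| ≤ B) (hd : ∀ S i z, |f (Function.update S i z) - f S| ≤ c) {t : ℝ}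
    (ht : 0 ≤ t) :
    (Measure.pi fun _ => D).real {S | t ≤ f S - ∫ S', f S' ∂(Measure.pi fun _ => D)} ≤
      Real.exp (-t ^ 2 / (2 * (n * c ^ 2))) := by
  set a := ∫ S', f S' ∂(Measure.pi fun _ => D) with ha
  have h : ProbabilityTheory.HasSubgaussianMGF (fun S => f S - a)
      ((n * c ^ 2 : ℝ).toNNReal) (Measure.pi fun _ => D) := by
    refine ⟨fun r => ?_, fun r => ?_⟩
    · refine integrable_of_abs_le (B := Real.exp (|r| * (B + |a|)))
        (Real.measurable_exp.comp ((hf.sub_const _).const_mul r)) fun S => ?_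
      rw [abs_of_pos (Real.exp_pos _), Real.exp_le_exp]
      refine (le_abs_self _).trans ?_
      rw [abs_mul]
      gcongr
      exact (abs_sub _ _).trans (add_le_add_left (hB S) _)
    · rw [Real.coe_toNNReal _ (by positivity)]
      exact integral_exp_le_of_bounded_differences D hc.le r hf hB hd
  have := h.measure_ge_le ht
  rwa [Real.coe_toNNReal _ (by positivity)] at this

section Suprema

variable {ι : Type*}

lemma bddAbove_range_of_abs_le {a : ι → ℝ} {B : ℝ} (h : ∀ t, |a t| ≤ B) :
    BddAbove (Set.range a) :=
  ⟨B, Set.forall_mem_range.2 fun t => (le_abs_self _).trans (h t)⟩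

lemma abs_ciSup_le [Nonempty ι] {a : ι → ℝ} {B : ℝ} (h : ∀ t, |a t| ≤ B) : |⨆ t, a t| ≤ B := by
  refine abs_le.2 ⟨?_, ciSup_le fun t => (le_abs_self _).trans (h t)⟩
  let t : ι := Classical.arbitrary ι
  exact (abs_le.1 (h t)).1.trans (le_ciSup (bddAbove_range_of_abs_le h) t)

lemma abs_ciSup_sub_ciSup_le [Nonempty ι] {a b : ι → ℝ} {B c : ℝ} (ha : ∀ t, |a t| ≤ B) (hb : ∀ t, |b t| ≤ B)
    (h : ∀ t, |a t - b t| ≤ c) : |(⨆ t, a t) - ⨆ t, b t| ≤ c := by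
  have h1 : ⨆ t, a t ≤ (⨆ t, b t) + c := ciSup_le fun t => by
    have := le_ciSup (bddAbove_range_of_abs_le hb) t
    have := (abs_le.1 (h t)).2
    linarith
  have h2 : ⨆ t, b t ≤ (⨆ t, a t) + c := ciSup_le fun t => by
    have := le_ciSup (bddAbove_range_of_abs_le ha) t
    have := (abs_le.1 (h t)).1
    linarith
  exact abs_le.2 ⟨by linarith, by linarith⟩

end Suprema

end Probability

/-! ### Symmetrization and uniform deviation. -/

section UniformDeviation

variable {Z : Type*} {ι : Type*} {n : ℕ}

/-- The average `n⁻¹ ∑ σᵢ h(Sᵢ)` with weights `σ`. -/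
def weightedMean (σ : Fin n → ℝ) (h : Z → ℝ) (S : Fin n → Z) : ℝ :=
  1 / (n : ℝ) * ∑ i, σ i * h (S i)

lemma abs_weightedMean_le (hn : 1 ≤ n) {σ : Fin n → ℝ} (hσ : ∀ i, |σ i| ≤ 1) {h : Z → ℝ} {M : ℝ}
    (hM : ∀ z, |h z| ≤ M) (S : Fin n → Z) : |weightedMean σ h S| ≤ M := by
  have hn' : (0 : ℝ) < n := by exact_mod_cast hn
  have h1 : |∑ i, σ i * h (S i)| ≤ n * M := by
    refine (Finset.abs_sum_le_sum_abs _ _).trans ?_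
    calc _ ≤ ∑ _i : Fin n, M := Finset.sum_le_sum fun i _ => by
          rw [abs_mul]
          exact (mul_le_of_le_one_left (abs_nonneg _) (hσ i)).trans (hM _)
      _ = _ := by simp
  rw [weightedMean, abs_mul, abs_of_pos (by positivity)]
  calc _ ≤ 1 / (n : ℝ) * (n * M) := by gcongr
    _ = M := by field_simp

lemma abs_signVal (u : ℤˣ) : |signVal u| = 1 := by
  rcases Int.units_eq_one_or u with rfl | rfl <;> simp

variable [MeasurableSpace Z]

lemma measurable_weightedMean (σ : Fin n → ℝ) {h : Z → ℝ} (hh : Measurable h) :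
    Measurable (weightedMean σ h) := by
  refine Measurable.const_mul (Finset.measurable_sum _ fun i _ => ?_) _
  exact (hh.comp (measurable_pi_apply i)).const_mul _

lemma integral_mean (hn : 1 ≤ n) (D : Measure Z) [IsProbabilityMeasure D] {h : Z → ℝ}
    (hh : Measurable h) {M : ℝ} (hM : ∀ z, |h z| ≤ M) :
    ∫ S, weightedMean 1 h S ∂(Measure.pi fun _ : Fin n => D) = ∫ z, h z ∂D := by
  have hn' : (n : ℝ) ≠ 0 := by positivity
  simp only [weightedMean, Pi.one_apply, one_mul]
  have hI : ∀ i ∈ Finset.univ,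
      Integrable (fun S : Fin n → Z => h (S i)) (Measure.pi fun _ : Fin n => D) := fun i _ =>
    integrable_of_abs_le (hh.comp (measurable_pi_apply i)) fun S => hM _
  rw [integral_const_mul, integral_finsetSum _ hI]
  have : ∀ i : Fin n, ∫ S, h (S i) ∂(Measure.pi fun _ : Fin n => D) = ∫ z, h z ∂D := fun i =>
    integral_comp_of_measurePreserving (measurePreserving_eval (fun _ : Fin n => D) i) hh
  simp only [this, Finset.sum_const, Finset.card_univ, Fintype.card_fin, nsmul_eq_mul]
  field_simp

/-- The largest difference between the mean and the empirical mean over a family of functions. -/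
def maxDeviation (D : Measure Z) (h : ι → Z → ℝ) (S : Fin n → Z) : ℝ :=
  ⨆ t, (∫ z, h t z ∂D - weightedMean 1 (h t) S)

/-- Exchange of the two components of the pairs `w i` with `ε i ≠ 1`. -/
def swapPairs (ε : Fin n → ℤˣ) (w : Fin n → Z × Z) : Fin n → Z × Z :=
  fun i => (if ε i = 1 then id else Prod.swap) (w i)

lemma measurePreserving_swapPairs (D : Measure Z) [IsProbabilityMeasure D] (ε : Fin n → ℤˣ) :
    MeasurePreserving (swapPairs ε) (Measure.pi fun _ : Fin n => D.prod D)
      (Measure.pi fun _ : Fin n => D.prod D) := by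
  refine measurePreserving_pi (f := fun i => if ε i = 1 then id else Prod.swap) _ _ fun i => ?_
  split_ifs
  · exact MeasurePreserving.id _
  · exact Measure.measurePreserving_swap

variable [Nonempty ι] [Countable ι]

/-- Symmetrization. The bound on Rademacher averages is stated for selectors `T`. -/
lemma integral_maxDeviation_le (hn : 1 ≤ n) (D : Measure Z) [IsProbabilityMeasure D]
    {h : ι → Z → ℝ} (hh : ∀ t, Measurable (h t)) {M : ℝ} (hM : ∀ t z, |h t z| ≤ M) {K : ℝ}
    (hK : ∀ (S : Fin n → Z) (T : (Fin n → ℤˣ) → ι),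
      ∑ ε, weightedMean (fun i => signVal (ε i)) (h (T ε)) S ≤ 2 ^ n * K) :
    ∫ S, maxDeviation D h S ∂(Measure.pi fun _ : Fin n => D) ≤ 2 * K := by
  set P := Measure.pi fun _ : Fin n => D
  set Q := Measure.pi fun _ : Fin n => D.prod D
  have hone : ∀ i : Fin n, |(1 : Fin n → ℝ) i| ≤ 1 := fun i => by simp
  have hmean : ∀ t (S : Fin n → Z), |weightedMean 1 (h t) S| ≤ M := fun t =>
    abs_weightedMean_le hn hone (hM t)
  have hmm : ∀ t, Measurable (weightedMean (1 : Fin n → ℝ) (h t)) := fun t =>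
    measurable_weightedMean _ (hh t)
  have hint : ∀ t, |∫ z, h t z ∂D| ≤ M := fun t => abs_integral_le_of_abs_le D (hM t)
  have hdevB : ∀ t (S : Fin n → Z), |∫ z, h t z ∂D - weightedMean 1 (h t) S| ≤ M + M :=
    fun t S => (abs_sub _ _).trans (add_le_add (hint t) (hmean t S))
  -- the symmetrized process
  let sym : (Fin n → Z) × (Fin n → Z) → ℝ := fun p =>
    ⨆ t, (weightedMean 1 (h t) p.2 - weightedMean 1 (h t) p.1)
  have hsymB : ∀ t (p : (Fin n → Z) × (Fin n → Z)),
      |weightedMean 1 (h t) p.2 - weightedMean 1 (h t) p.1| ≤ M + M :=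
    fun t p => (abs_sub _ _).trans (add_le_add (hmean t _) (hmean t _))
  have hsymM : Measurable sym := Measurable.iSup fun t =>
    ((hmm t).comp measurable_snd).sub ((hmm t).comp measurable_fst)
  have hsym_le : ∀ p, |sym p| ≤ M + M := fun p => abs_ciSup_le fun t => hsymB t p
  have h1 : ∀ S, maxDeviation D h S ≤ ∫ S', sym (S, S') ∂P := by
    intro S
    refine ciSup_le fun t => ?_
    -- A ghost sample `S'` replaces the population mean.
    have e : ∫ z, h t z ∂D - weightedMean 1 (h t) S =
        ∫ S', (weightedMean 1 (h t) S' - weightedMean 1 (h t) S) ∂P := by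
      rw [integral_sub (integrable_of_abs_le (hmm t) (hmean t)) (integrable_const _),
        integral_mean hn D (hh t) (hM t)]
      simp
    rw [e]
    refine integral_mono (integrable_of_abs_le ((hmm t).sub_const _) fun S' => hsymB t (S, S'))
      (integrable_of_abs_le (hsymM.comp measurable_prodMk_left) fun S' => hsym_le _) fun S' => ?_
    exact le_ciSup (bddAbove_range_of_abs_le fun t => hsymB t (S, S')) t
  have h2 : ∫ S, maxDeviation D h S ∂P ≤ ∫ p, sym p ∂(P.prod P) := by
    rw [integral_prod _ (integrable_of_abs_le hsymM hsym_le)]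
    refine integral_mono (integrable_of_abs_le (B := M + M) ?_ fun S =>
      abs_ciSup_le fun t => hdevB t S) (integrable_of_abs_le (B := M + M) ?_ fun S =>
      abs_integral_le_of_abs_le _ fun S' => hsym_le _) h1
    · exact Measurable.iSup fun t => (hmm t).const_sub _
    · exact hsymM.stronglyMeasurable.integral_prod_right.measurable
  -- the Rademacher averages
  let rad : (Fin n → ℤˣ) → (Fin n → Z) → ℝ := fun ε S =>
    ⨆ t, weightedMean (fun i => signVal (ε i)) (h t) S
  have hradt : ∀ (ε : Fin n → ℤˣ) t S, |weightedMean (fun i => signVal (ε i)) (h t) S| ≤ M := fun ε t =>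
    abs_weightedMean_le hn (fun i => (abs_signVal _).le) (hM t)
  have hradB : ∀ ε S, |rad ε S| ≤ M := fun ε S => abs_ciSup_le fun t => hradt ε t S
  have hradM : ∀ ε, Measurable (rad ε) := fun ε => Measurable.iSup fun t =>
    measurable_weightedMean _ (hh t)
  have hradI : ∀ ε, Integrable (rad ε) P := fun ε => integrable_of_abs_le (hradM ε) (hradB ε)
  have hfst : MeasurePreserving (fun (w : Fin n → Z × Z) i => (w i).1) Q P :=
    measurePreserving_pi (f := fun _ => Prod.fst) _ _ fun _ => measurePreserving_fst
  have hsnd : MeasurePreserving (fun (w : Fin n → Z × Z) i => (w i).2) Q P :=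
    measurePreserving_pi (f := fun _ => Prod.snd) _ _ fun _ => measurePreserving_snd
  have hpair : MeasurePreserving
      (fun w : Fin n → Z × Z => (fun i => (w i).1, fun i => (w i).2)) Q (P.prod P) :=
    measurePreserving_arrowProdEquivProdArrow Z Z (Fin n) (fun _ => D) (fun _ => D)
  have h3 : ∀ ε, ∫ p, sym p ∂(P.prod P) ≤ ∫ S, rad ε S ∂P + ∫ S, rad (-ε) S ∂P := by
    intro ε
    have hi₂ : Integrable (fun w : Fin n → Z × Z => rad ε fun i => (w i).2) Q :=
      integrable_of_abs_le ((hradM ε).comp hsnd.measurable) fun w => hradB _ _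
    have hi₁ : Integrable (fun w : Fin n → Z × Z => rad (-ε) fun i => (w i).1) Q :=
      integrable_of_abs_le ((hradM (-ε)).comp hfst.measurable) fun w => hradB _ _
    -- Swapping the pairs with `ε i = -1` preserves the law and puts the signs on the differences.
    rw [← integral_comp_of_measurePreserving (hpair.comp (measurePreserving_swapPairs D ε)) hsymM,
      ← integral_comp_of_measurePreserving hsnd (hradM ε),
      ← integral_comp_of_measurePreserving hfst (hradM (-ε)),
      ← integral_add hi₂ hi₁]
    refine integral_mono
      (integrable_of_abs_le
        (hsymM.comp (hpair.comp (measurePreserving_swapPairs D ε)).measurable) fun w => hsym_le _)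
      (hi₂.add hi₁) fun w => ?_
    refine ciSup_le fun t => ?_
    have e : weightedMean 1 (h t) (fun i => (swapPairs ε w i).2) -
        weightedMean 1 (h t) (fun i => (swapPairs ε w i).1) =
        weightedMean (fun i => signVal (ε i)) (h t) (fun i => (w i).2) +
          weightedMean (fun i => signVal ((-ε) i)) (h t) (fun i => (w i).1) := by
      simp only [weightedMean]
      rw [← mul_sub, ← mul_add, ← Finset.sum_sub_distrib, ← Finset.sum_add_distrib]
      congr 1
      refine Finset.sum_congr rfl fun i _ => ?_
      rcases Int.units_eq_one_or (ε i) with hi | hi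
      · simp [swapPairs, hi, sub_eq_add_neg]
      · have : (-1 : ℤˣ) ≠ 1 := by decide
        simp [swapPairs, hi, this]
        ring
    refine e.le.trans (add_le_add ?_ ?_)
    · exact le_ciSup (bddAbove_range_of_abs_le fun t => hradt ε t _) t
    · exact le_ciSup (bddAbove_range_of_abs_le fun t => hradt (-ε) t _) t
  have h4 : ∀ S, ∑ ε, rad ε S ≤ 2 ^ n * K := by
    intro S
    -- The suprema need not be attained, so near-maximizers serve as selectors, with total error
    -- `η`.
    refine le_of_forall_pos_le_add fun η hη => ?_
    have hpos : (0 : ℝ) < 2 ^ n := by positivity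
    choose T hT using fun ε => exists_lt_of_lt_ciSup
      (show rad ε S - η / 2 ^ n < ⨆ t, weightedMean (fun i => signVal (ε i)) (h t) S from
        sub_lt_self _ (by positivity))
    calc _ ≤ ∑ ε, (weightedMean (fun i => signVal (ε i)) (h (T ε)) S + η / 2 ^ n) :=
          Finset.sum_le_sum fun ε _ => by linarith [hT ε]
      _ = ∑ ε, weightedMean (fun i => signVal (ε i)) (h (T ε)) S + η := by
          rw [Finset.sum_add_distrib, Finset.sum_const, Finset.card_univ, card_signs,
            nsmul_eq_mul]
          push_cast
          rw [mul_div_cancel₀ _ hpos.ne']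
      _ ≤ _ := by linarith [hK S T]
  have h5 : ∑ ε, ∫ S, rad ε S ∂P ≤ 2 ^ n * K := by
    rw [← integral_finsetSum _ fun ε _ => hradI ε]
    have := integral_mono (integrable_finsetSum Finset.univ fun ε _ => hradI ε)
      (integrable_const (μ := P) (2 ^ n * K)) h4
    simpa using this
  have h6 : ∑ ε, ∫ S, rad (-ε) S ∂P = ∑ ε, ∫ S, rad ε S ∂P :=
    Equiv.sum_comp (Equiv.neg (Fin n → ℤˣ)) fun ε => ∫ S, rad ε S ∂P
  have h7 : 2 ^ n * ∫ S, maxDeviation D h S ∂P ≤ 2 ^ n * (2 * K) := by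
    calc _ = ∑ _ε : Fin n → ℤˣ, ∫ S, maxDeviation D h S ∂P := by
          rw [Finset.sum_const, Finset.card_univ, card_signs, nsmul_eq_mul]
          push_cast
          rfl
      _ ≤ ∑ ε, (∫ S, rad ε S ∂P + ∫ S, rad (-ε) S ∂P) :=
          Finset.sum_le_sum fun ε _ => h2.trans (h3 ε)
      _ ≤ _ := by rw [Finset.sum_add_distrib, h6]; linarith
  exact le_of_mul_le_mul_left h7 (by positivity)

/-- A uniform deviation bound from a bound on Rademacher averages. -/
theorem exists_measurableSet_forall_deviation_le (hn : 1 ≤ n) (D : Measure Z)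
    [IsProbabilityMeasure D] {h : ι → Z → ℝ} (hh : ∀ t, Measurable (h t)) {M : ℝ} (hM0 : 0 < M)
    (hM : ∀ t z, h t z ∈ Set.Icc 0 M) {K : ℝ}
    (hK : ∀ (S : Fin n → Z) (T : (Fin n → ℤˣ) → ι),
      ∑ ε, weightedMean (fun i => signVal (ε i)) (h (T ε)) S ≤ 2 ^ n * K)
    {δ : ℝ} (hδ0 : 0 < δ) (hδ1 : δ < 1) :
    ∃ E : Set (Fin n → Z), MeasurableSet E ∧ 1 - δ ≤ (Measure.pi fun _ : Fin n => D).real E ∧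
      ∀ S ∈ E, ∀ t, ∫ z, h t z ∂D - weightedMean 1 (h t) S ≤
        2 * K + M * (√(2 * Real.log (1 / δ)) / √n) := by
  have hn' : (0 : ℝ) < n := by exact_mod_cast hn
  have hMabs : ∀ t z, |h t z| ≤ M := fun t z => by
    rw [abs_of_nonneg (hM t z).1]; exact (hM t z).2
  have hdevB : ∀ t (S : Fin n → Z), |∫ z, h t z ∂D - weightedMean 1 (h t) S| ≤ M + M :=
    fun t S => (abs_sub _ _).trans (add_le_add (abs_integral_le_of_abs_le D (hMabs t))
      (abs_weightedMean_le hn (fun i => by simp) (hMabs t) S))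
  have hGm : Measurable (maxDeviation (n := n) D h) := Measurable.iSup fun t =>
    (measurable_weightedMean _ (hh t)).const_sub _
  have hlog : 0 < Real.log (1 / δ) := Real.log_pos (by rw [lt_div_iff₀ hδ0]; linarith)
  -- Chosen so that the tail bound with differences `M / n` equals exactly `δ`.
  set t₀ := M * (√(2 * Real.log (1 / δ)) / √n) with ht₀
  have hd : ∀ (S : Fin n → Z) i z,
      |maxDeviation D h (Function.update S i z) - maxDeviation D h S| ≤ M / n := by
    intro S i z
    refine abs_ciSup_sub_ciSup_le (fun t => hdevB t _) (fun t => hdevB t _) fun t => ?_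
    rw [sub_sub_sub_cancel_left]
    have e : weightedMean 1 (h t) S - weightedMean 1 (h t) (Function.update S i z) =
        1 / (n : ℝ) * (h t (S i) - h t z) := by
      simp only [weightedMean, Pi.one_apply, one_mul]
      rw [← mul_sub, ← Finset.sum_sub_distrib, Finset.sum_eq_single i]
      · simp
      · intro j _ hj
        simp [Function.update_of_ne hj]
      · simp
    rw [e, abs_mul, abs_of_pos (by positivity), one_div, inv_mul_eq_div]
    gcongr
    rw [abs_le]
    have h1 := hM t (S i)
    have h2 := hM t z
    constructor <;> linarith [h1.1, h1.2, h2.1, h2.2]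
  have htail := measureReal_ge_le_of_bounded_differences D hn hGm (by positivity : 0 < M / n)
    (fun S => abs_ciSup_le fun t => hdevB t S) hd (by positivity : 0 ≤ t₀)
  have hexp : Real.exp (-t₀ ^ 2 / (2 * (n * (M / n) ^ 2))) = δ := by
    have : -t₀ ^ 2 / (2 * (n * (M / n) ^ 2)) = Real.log δ := by
      rw [ht₀, mul_pow, div_pow, Real.sq_sqrt (by positivity), Real.sq_sqrt hn'.le, one_div,
        Real.log_inv]
      field_simp
    rw [this, Real.exp_log hδ0]
  rw [hexp] at htail
  have hE := integral_maxDeviation_le hn D hh hMabs hK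
  set a := ∫ S, maxDeviation D h S ∂(Measure.pi fun _ : Fin n => D)
  have hmeas : MeasurableSet {S : Fin n → Z | t₀ ≤ maxDeviation D h S - a} :=
    measurableSet_le measurable_const (hGm.sub_const _)
  refine ⟨{S | t₀ ≤ maxDeviation D h S - a}ᶜ, hmeas.compl, ?_, fun S hS t => ?_⟩
  · rw [probReal_compl_eq_one_sub hmeas]
    linarith
  · have h1 : maxDeviation D h S - a < t₀ := not_le.1 hS
    have h2 : ∫ z, h t z ∂D - weightedMean 1 (h t) S ≤ maxDeviation D h S :=
      le_ciSup (bddAbove_range_of_abs_le fun t => hdevB t S) t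
    linarith

end UniformDeviation

/-! ### Continuity in the parameters and truncation of the data. -/

section Network

variable {φ : ℝ → ℝ} {L : ℕ} {m : ℕ → ℕ}

/-- Continuity is asked only of the normalized weights, because `w ↦ w / ‖w‖` jumps at `0`. The form
covers dependence on both data and parameters. -/
lemma continuous_activation (hφ : Continuous φ) {X : Type*} [TopologicalSpace X]
    {θ : X → Params L m} {x : X → EuclideanSpace ℝ (Fin (m 0))}
    (hW : ∀ l i, Continuous fun p => ‖(θ p).W l i‖⁻¹ • (θ p).W l i) (hx : Continuous x)
    (l : ℕ) (hl : l ≤ L) : Continuous fun p => activation φ (θ p) (x p) l hl := by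
  induction l with
  | zero => exact hx
  | succ l ih =>
    refine (PiLp.continuous_toLp 2 _).comp (continuous_pi fun i => hφ.comp ?_)
    exact continuous_const.mul ((hW ⟨l, hl⟩ i).inner (ih _))

lemma continuous_predictor (hφ : Continuous φ) {X : Type*} [TopologicalSpace X]
    {θ : X → Params L m} {x : X → EuclideanSpace ℝ (Fin (m 0))}
    (hW : ∀ l i, Continuous fun p => ‖(θ p).W l i‖⁻¹ • (θ p).W l i)
    (hv : Continuous fun p => (θ p).v) (hx : Continuous x) :
    Continuous fun p => predictor φ (θ p) (x p) :=
  hv.inner (continuous_activation hφ hW hx L le_rfl)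

/-- The weight vectors normalized as they enter the network, together with the output layer. -/
def Params.normalize (θ : Params L m) :
    ((l : Fin L) → Fin (m (l + 1)) → EuclideanSpace ℝ (Fin (m l))) × EuclideanSpace ℝ (Fin (m L)) :=
  (fun l i => ‖θ.W l i‖⁻¹ • θ.W l i, θ.v)

/-- The parameters carry the topology in which two of them with the same normalized weight vectors
and the same output layer cannot be told apart. -/
instance : TopologicalSpace (Params L m) := .induced Params.normalize inferInstance

instance : SecondCountableTopology (Params L m) :=
  TopologicalSpace.secondCountableTopology_induced _ _ _

lemma Params.continuous_normalize : Continuous (Params.normalize (L := L) (m := m)) :=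
  continuous_induced_dom

lemma Params.continuous_v : Continuous fun θ : Params L m => θ.v :=
  continuous_snd.comp Params.continuous_normalize

lemma Params.continuous_normalized_W (l : Fin L) (i : Fin (m (l + 1))) :
    Continuous fun θ : Params L m => ‖θ.W l i‖⁻¹ • θ.W l i :=
  (continuous_apply i).comp ((continuous_apply l).comp
    (continuous_fst.comp Params.continuous_normalize))

/-- Replaces data points outside the product of the unit balls by `0`. -/
def truncate (z : EuclideanSpace ℝ (Fin (m 0)) × ℝ) : EuclideanSpace ℝ (Fin (m 0)) × ℝ :=
  open Classical in if ‖z.1‖ ≤ 1 ∧ |z.2| ≤ 1 then z else 0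

lemma measurable_truncate : Measurable (truncate (m := m)) := by
  classical
  refine Measurable.ite (MeasurableSet.inter ?_ ?_) measurable_id measurable_const
  · exact measurableSet_le measurable_fst.norm measurable_const
  · exact measurableSet_le measurable_snd.abs measurable_const

lemma truncate_of_le {z : EuclideanSpace ℝ (Fin (m 0)) × ℝ} (hz : ‖z.1‖ ≤ 1 ∧ |z.2| ≤ 1) :
    truncate z = z := if_pos hz

lemma truncate_le (z : EuclideanSpace ℝ (Fin (m 0)) × ℝ) :
    ‖(truncate z).1‖ ≤ 1 ∧ |(truncate z).2| ≤ 1 := by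
  unfold truncate
  split_ifs with h
  · exact h
  · simp

/-- The square loss at the truncated data points. -/
def truncatedLoss (φ : ℝ → ℝ) (θ : Params L m) (z : EuclideanSpace ℝ (Fin (m 0)) × ℝ) : ℝ :=
  sqLoss (truncate z).2 (predictor φ θ (truncate z).1)

lemma truncatedLoss_of_le {θ : Params L m} {z : EuclideanSpace ℝ (Fin (m 0)) × ℝ}
    (hz : ‖z.1‖ ≤ 1 ∧ |z.2| ≤ 1) : truncatedLoss φ θ z = sqLoss z.2 (predictor φ θ z.1) := by
  rw [truncatedLoss, truncate_of_le hz]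

lemma measurable_truncatedLoss (hφ : Continuous φ) (θ : Params L m) :
    Measurable (truncatedLoss φ θ) := by
  have h : Measurable (predictor φ θ) :=
    (continuous_predictor (θ := fun _ => θ) hφ (fun _ _ => continuous_const) continuous_const
      continuous_id).measurable
  exact ((measurable_snd.comp measurable_truncate).sub
    (h.comp (measurable_fst.comp measurable_truncate))).pow_const 2

lemma continuous_truncatedLoss (hφ : Continuous φ) (z : EuclideanSpace ℝ (Fin (m 0)) × ℝ) :
    Continuous fun θ : Params L m => truncatedLoss φ θ z :=
  (continuous_const.sub (continuous_predictor hφ Params.continuous_normalized_W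
    Params.continuous_v continuous_const)).pow 2

lemma truncatedLoss_mem_Icc (hφ : ∀ s t, |φ s - φ t| ≤ |s - t|) (hφ0 : φ 0 = 0) {R : ℝ}
    {θ : Params L m} (hθ : ‖θ.v‖ ≤ R) (z : EuclideanSpace ℝ (Fin (m 0)) × ℝ) :
    truncatedLoss φ θ z ∈ Set.Icc 0 ((1 + R) ^ 2) := by
  refine ⟨sq_nonneg _, ?_⟩
  have h := truncate_le z
  refine sq_le_sq' ?_ ?_ <;>
    linarith [(abs_le.1 h.2).1, (abs_le.1 h.2).2,
      (abs_le.1 (abs_predictor_le hφ hφ0 hθ h.1)).1, (abs_le.1 (abs_predictor_le hφ hφ0 hθ h.1)).2]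

end Network

end WeightNorm

end

open WeightNorm

/-! ### Assembly of the generalization bound. -/

theorem mainTheorem8
    (φ : ℝ → ℝ) (β : ℝ) (hφ : WeightNorm.ActivationAssumption φ β) (hφ0 : φ 0 = 0)
    (L : ℕ) (hL : 1 ≤ L) (m : ℕ → ℕ)
    (v₀ : EuclideanSpace ℝ (Fin (m L))) (hv₀ : ‖v₀‖ = 1) (ρ₁ : ℝ) (hρ₁ : 0 < ρ₁)
    (D : MeasureTheory.Measure (EuclideanSpace ℝ (Fin (m 0)) × ℝ))
    [MeasureTheory.IsProbabilityMeasure D]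
    (hx : ∀ᵐ z ∂D, ‖z.1‖ = 1) (hy : ∀ᵐ z ∂D, |z.2| ≤ 1)
    (n : ℕ) (hn : 1 ≤ n) (δ : ℝ) (hδ0 : 0 < δ) (hδ1 : δ < 1) :
    ∃ E : Set (Fin n → EuclideanSpace ℝ (Fin (m 0)) × ℝ),
      MeasurableSet E ∧
      1 - δ ≤ (MeasureTheory.Measure.pi fun _ : Fin n => D).real E ∧
      ∀ S ∈ E, ∀ θ : WeightNorm.Params L m, θ.v ∈ Metric.closedBall v₀ ρ₁ →
        WeightNorm.populationLoss φ D θ - WeightNorm.empiricalLoss φ S θ ≤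
          4 * (2 + ρ₁) * (1 + ρ₁) * ((√(2 * Real.log 2 * L) + 1) / √n)
            + 2 * (1 + (1 + ρ₁) ^ 2) * (√(2 * Real.log (2 / δ)) / √n) := by
  have hlip := hφ.abs_sub_le
  have hcont : Continuous φ := hφ.differentiable.continuous
  have hn' : (0 : ℝ) < n := by exact_mod_cast hn
  have hgood : ∀ᵐ z ∂D, ‖z.1‖ ≤ 1 ∧ |z.2| ≤ 1 := by
    filter_upwards [hx, hy] with z h1 h2 using ⟨h1.le, h2⟩
  let Θ : Set (Params L m) := {θ | θ.v ∈ Metric.closedBall v₀ ρ₁}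
  have hΘ : ∀ θ : Θ, ‖θ.1.v‖ ≤ 1 + ρ₁ := fun θ => by
    have h1 : ‖θ.1.v - v₀‖ ≤ ρ₁ := mem_closedBall_iff_norm.1 θ.2
    have h2 := norm_add_le v₀ (θ.1.v - v₀)
    rw [add_sub_cancel] at h2
    linarith
  have : Nonempty Θ := ⟨⟨⟨fun _ _ => 0, v₀⟩, Metric.mem_closedBall_self hρ₁.le⟩⟩
  -- The deviation bound is proved along a dense sequence, where suprema are countable, and extended
  -- by continuity.
  let seq : ℕ → Θ := TopologicalSpace.denseSeq Θ
  have hIcc : ∀ (θ : Θ) z, truncatedLoss φ θ.1 z ∈ Set.Icc 0 ((1 + (1 + ρ₁)) ^ 2) := fun θ =>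
    truncatedLoss_mem_Icc hlip hφ0 (hΘ θ)
  set A := √(2 * Real.log 2 * L) + 1
  set K := 1 / (n : ℝ) * (2 * (1 + (1 + ρ₁)) * (1 + ρ₁) * (√n * A)) with hK
  obtain ⟨E, hEm, hE, hdev⟩ := exists_measurableSet_forall_deviation_le hn D
    (h := fun k => truncatedLoss φ (seq k).1) (K := K) (M := (1 + (1 + ρ₁)) ^ 2)
    (fun k => measurable_truncatedLoss hcont _) (by positivity) (fun k => hIcc (seq k))
    (fun S T => by
      have := sum_sign_sqLoss_le hlip hφ0 hn hL (by positivity : 0 ≤ 1 + ρ₁)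
        (x := fun i => (truncate (S i)).1) (fun i => (truncate_le (S i)).1)
        (y := fun i => (truncate (S i)).2) (fun i => (truncate_le (S i)).2)
        (fun ε => ⟨(seq (T ε)).1, hΘ _⟩)
      simp only [weightedMean]
      rw [← Finset.mul_sum, hK, mul_left_comm]
      exact mul_le_mul_of_nonneg_left this (by positivity)) hδ0 hδ1
  have hgoodm : MeasurableSet {S : Fin n → EuclideanSpace ℝ (Fin (m 0)) × ℝ |
      ∀ i, ‖(S i).1‖ ≤ 1 ∧ |(S i).2| ≤ 1} := by
    refine measurableSet_setOfPred.2 (Measurable.forall fun i => measurableSet_setOfPred.1 ?_)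
    have hi : Measurable fun S : Fin n → EuclideanSpace ℝ (Fin (m 0)) × ℝ => S i :=
      measurable_pi_apply i
    exact (measurableSet_le hi.fst.norm measurable_const).inter
      (measurableSet_le hi.snd.abs measurable_const)
  have hgoodS : ∀ᵐ S ∂(MeasureTheory.Measure.pi fun _ : Fin n => D),
      ∀ i, ‖(S i).1‖ ≤ 1 ∧ |(S i).2| ≤ 1 := MeasureTheory.ae_all_iff.2 fun i =>
    (MeasureTheory.measurePreserving_eval (fun _ : Fin n => D) i).quasiMeasurePreserving.ae hgood
  -- The intersection removes a null set; on it, truncated and original empirical losses agree.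
  refine ⟨E ∩ {S | ∀ i, ‖(S i).1‖ ≤ 1 ∧ |(S i).2| ≤ 1}, hEm.inter hgoodm, ?_, ?_⟩
  · refine hE.trans (le_of_eq (MeasureTheory.measureReal_congr ?_))
    filter_upwards [hgoodS] with S hS
    exact propext ⟨fun h => ⟨h, hS⟩, fun h => h.1⟩
  · rintro S ⟨hSE, hS⟩ θ hθ
    have hpop : populationLoss φ D θ = ∫ z, truncatedLoss φ θ z ∂D :=
      MeasureTheory.integral_congr_ae (by
        filter_upwards [hgood] with z hz using (truncatedLoss_of_le hz).symm)
    have hemp : empiricalLoss φ S θ = weightedMean 1 (truncatedLoss φ θ) S := by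
      simp only [empiricalLoss, weightedMean, Pi.one_apply, one_mul, truncatedLoss_of_le (hS _)]
    have hclosed : IsClosed {θ : Θ | ∫ z, truncatedLoss φ θ.1 z ∂D -
        weightedMean 1 (truncatedLoss φ θ.1) S ≤
          2 * K + (1 + (1 + ρ₁)) ^ 2 * (√(2 * Real.log (1 / δ)) / √n)} := by
      refine isClosed_le (Continuous.sub ?_ ?_) continuous_const
      · refine MeasureTheory.continuous_of_dominated (bound := fun _ => (1 + (1 + ρ₁)) ^ 2)
          (fun θ => (measurable_truncatedLoss hcont _).aestronglyMeasurable)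
          (fun θ => .of_forall fun z => ?_) (MeasureTheory.integrable_const _)
          (.of_forall fun z => (continuous_truncatedLoss hcont z).comp continuous_subtype_val)
        rw [Real.norm_of_nonneg (hIcc θ z).1]
        exact (hIcc θ z).2
      · refine continuous_const.mul (continuous_finsetSum _ fun i _ => continuous_const.mul ?_)
        exact (continuous_truncatedLoss hcont _).comp continuous_subtype_val
    have hall := isClosed_property (TopologicalSpace.denseRange_denseSeq Θ) hclosed
      (fun k => hdev S hSE k) ⟨θ, hθ⟩
    rw [hpop, hemp]
    refine hall.trans (add_le_add (le_of_eq ?_) ?_)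
    · have hs : √(n : ℝ) * √n = n := Real.mul_self_sqrt hn'.le
      rw [hK]
      nth_rw 1 [← hs]
      field_simp
      ring
    · gcongr
      -- This is `(2 + ρ₁)² ≤ 2 (1 + (1 + ρ₁)²)`, an instance of `(a + b)² ≤ 2 (a² + b²)`.
      · nlinarith [sq_nonneg ρ₁]
      · norm_num
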